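/- **Networks.** A network $\mathcal N$ consists of a finite directed acyclic multigraph with node set $\mathcal V$ and link set $\mathcal E$, distinct source nodes $\sigma_1,\dots,\sigma_s$ ($s\ge 1$) and a sink node $\gamma\notin\{\sigma_1,\dots,\sigma_s\}$, such that no source has an incoming link and every node other than $\gamma$ has a directed path to $\gamma$. A cut of $\mathcal N$ is a set $C\subseteq\mathcal E$ that meets every directed path from $\sigma_i$ to $\gamma$ for at least one $i$. Write $I_C$ for the set of sources that have no path to $\gamma$ after $C$ is deleted, and $\Lambda(\mathcal N)$ for the set of all cuts. **Codes.** Let $k\ge1$. A (scalar) linear network code $\mathcal C$ over $\mathbb F_q$ for $\mathcal N$ in which each source generates $k$ symbols consists of a matrix $B\in\mathbb F_q^{sk\times\mathcal E}$ whose entry in row $(i,j)$ and column $e$ is $0$ unless $e$ starts at $\sigma_i$, and a matrix $K\in\mathbb F_q^{\mathcal E\times\mathcal E}$ whose entry $(d,e)$ is $0$ unless $e$ starts at the end node of $d$. Let $G$ be the submatrix of $(I-K)^{-1}$ formed by the columns of the links entering $\gamma$, and let $F=BG$; for source messages $\mathbf x\in\mathbb F_q^{sk}$ and link errors $\mathbf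 z\in\mathbb F_q^{\mathcal E}$ the sink receives $\mathbf xF+\mathbf zG$. The code computes the identity function with rate $k$ if $\mathbf x$ is determined by $\mathbf xF$. For $\rho\subseteq\mathcal E$ (an error pattern) let $\Delta(\rho)=\{\mathbf zG:\ z_e=0\text{ for }e\notin\rho\}$. The minimum distance is $$d_{\min}(\mathcal C,I,k)=\min\{|\rho|:\ \mathbf xF\in\Delta(\rho)\text{ for some }\mathbf x\ne\mathbf 0\}.$$ **Rank.** The rank $\mathrm{Rank}(\rho)$ is the least size of a set $\rho'\subseteq\mathcal E$ such that $\Delta(\rho)\subseteq\Delta(\rho')$ for every linear network code over $\mathbb F_q$ for $\mathcal N$. Let $R(\delta)=\{\rho\subseteq\mathcal E:\ |\rho|=\mathrm{Rank}(\rho)=\delta\}$. **Theorem.** Let $\mathcal N$ be a directed acyclic network, let $k\ge1$, and suppose that $$\delta=\min_{C\in\Lambda(\mathcal N)}\bigl(|C|-k|I_C|\bigr)$$ is non-negative. If $q\ge|R(\delta)|$, then there is a linear network code $\mathcal C$ over $\mathbb F_q$ for $\mathcal N$ that computes the identity function with rate $k$ and satisfies $d_{\min}(\mathcal C,I,k)=\delta+1$.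 -/

import Mathlib

/-- `p` is a (nonempty) directed path from `u` to `v` in the directed multigraph given by
`tail, head : E → V`. -/
def IsDirPath {V E : Type*} (tail head : E → V) (u v : V) (p : List E) : Prop :=
  ∃ h : p ≠ [], tail (p.head h) = u ∧ head (p.getLast h) = v ∧
    p.IsChain (fun d e => head d = tail e)

/-- `T ⊗ I_k`. -/
def targetMatrix {F : Type*} [Field F] {s l : ℕ} (T : Matrix (Fin s) (Fin l) F) (k : ℕ) :
    Matrix (Fin s × Fin k) (Fin l × Fin k) F :=
  Matrix.kroneckerMap (· * ·) T (1 : Matrix (Fin k) (Fin k) F)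

/-- A directed acyclic network with node set `V`, link set `E` (parallel links are allowed),
distinct source nodes `source 0, …, source (s - 1)` and one sink node. -/
structure AcyclicNetwork (V E : Type*) (s : ℕ) where
  tail : E → V
  head : E → V
  source : Fin s → V
  sink : V
  source_injective : Function.Injective source
  source_ne_sink : ∀ i, source i ≠ sink
  acyclic : ∀ (v : V) (p : List E), ¬ IsDirPath tail head v v p
  source_no_in : ∀ (i : Fin s) (e : E), head e ≠ source i
  exists_path_sink : ∀ u : V, u ≠ sink → ∃ p, IsDirPath tail head u sink p

namespace AcyclicNetwork

variable {V E : Type*} {s : ℕ} (N : AcyclicNetwork V E s)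

/-- `In(v)`. -/
def In (v : V) : Set E := {e | N.head e = v}

/-- `C` separates `u` from `v`: every path from `u` to `v` uses a link of `C`. -/
def IsCutBetween (C : Finset E) (u v : V) : Prop :=
  ∀ p : List E, IsDirPath N.tail N.head u v p → ∃ e ∈ p, e ∈ C

/-- The cuts of the network, `Λ(N)`. -/
def cuts : Set (Finset E) := {C | ∃ i, N.IsCutBetween C (N.source i) N.sink}

/-- `I_C`: the (indices of the) sources with no path to the sink after deleting `C`. -/
def cutSources (C : Finset E) : Set (Fin s) :=
  {i | ¬ ∃ p : List E, IsDirPath N.tail N.head (N.source i) N.sink p ∧ ∀ e ∈ p, e ∉ C}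

/-- A scalar linear network code over `F` in which each source generates `k` symbols:
the local encoding coefficients `k_{(i,j),e}` and `k_{d,e}`. -/
structure LinearCode (F : Type*) [Field F] (k : ℕ) where
  /-- The source encoding matrices `B_1, …, B_s`, stacked. -/
  B : Matrix (Fin s × Fin k) E F
  /-- The transfer matrix. -/
  K : Matrix E E F
  B_eq_zero : ∀ i j e, N.tail e ≠ N.source i → B (i, j) e = 0
  K_eq_zero : ∀ d e, N.tail e ≠ N.head d → K d e = 0

namespace LinearCode

variable {N} {F : Type*} [Field F] {k l : ℕ} (𝒞 : N.LinearCode F k)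

/-- `u` is the family of symbols carried by the links when the source messages are `x` and the
error vector is `z`.  (Source nodes have no incoming links, and `B` vanishes on links that do not
start at a source, so only one of the two sums is present for a given link.) -/
def IsTransmission [Fintype E] (x : Fin s × Fin k → F) (z u : E → F) : Prop :=
  ∀ e, u e = ∑ ij, x ij * 𝒞.B ij e + ∑ d, u d * 𝒞.K d e + z e

variable [Fintype E] [DecidableEq E]

/-- The part `G` of the extended global encoding matrix that belongs to the errors. -/
noncomputable def G : Matrix E (N.In N.sink) F :=
  ((1 - 𝒞.K)⁻¹).submatrix id Subtype.val

/-- The global encoding matrix. -/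
noncomputable def globalMatrix : Matrix (Fin s × Fin k) (N.In N.sink) F :=
  𝒞.B * 𝒞.G

/-- `1 - K` is invertible, by acyclicity, so the inverse in `G` is a genuine one. -/
theorem isUnit_one_sub_K : IsUnit (1 - 𝒞.K) := by
  have hpath : ∀ d e : E, Relation.TransGen (fun d e => N.head d = N.tail e) d e →
      ∃ p : List E, IsDirPath N.tail N.head (N.tail d) (N.tail e) p := by
    intro d e h
    induction h with
    | single h => exact ⟨[d], by simp, rfl, h, by simp⟩
    | @tail b c _ hbc ih =>
      obtain ⟨p, hp, h1, h2, h3⟩ := ih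
      refine ⟨p ++ [b], by simp, ?_, by simpa using hbc, ?_⟩
      · rw [List.head_append_of_ne_nil hp]; exact h1
      · rw [List.isChain_append]
        refine ⟨h3, by simp, ?_⟩
        intro x hx y hy
        rw [List.getLast?_eq_getLast_of_ne_nil hp] at hx
        simp only [Option.mem_def, Option.some.injEq, List.head?_cons] at hx hy
        subst hx; subst hy; exact h2
  have hwf : WellFounded (Relation.TransGen (fun d e : E => N.head d = N.tail e)) := by
    have : Std.Irrefl (Relation.TransGen (fun d e : E => N.head d = N.tail e)) :=
      ⟨fun e h => by
        obtain ⟨p, hp⟩ := hpath e e h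
        exact N.acyclic _ p hp⟩
    exact Finite.wellFounded_of_trans_of_irrefl _
  rw [← Matrix.vecMul_injective_iff_isUnit]
  have key : ∀ v : E → F, Matrix.vecMul v (1 - 𝒞.K) = 0 → v = 0 := by
    intro v hv
    rw [Matrix.vecMul_sub, Matrix.vecMul_one, sub_eq_zero] at hv
    funext e
    induction e using hwf.induction with
    | _ e ih =>
      rw [hv]
      refine Finset.sum_eq_zero fun d _ => ?_
      by_cases hd : N.tail e = N.head d
      · rw [ih d (Relation.TransGen.single hd.symm)]; simp
      · have h0 : 𝒞.K d e = 0 := 𝒞.K_eq_zero d e hd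
        change v d * 𝒞.K d e = 0
        rw [h0, mul_zero]
  intro v w hvw
  have := key (v - w) (by
    rw [Matrix.sub_vecMul]
    exact sub_eq_zero.mpr hvw)
  exact sub_eq_zero.mp this

/-- The symbols received by the sink are `x F + z G`. -/
theorem received_eq {x : Fin s × Fin k → F} {z u : E → F} (h : 𝒞.IsTransmission x z u) :
    (fun e : N.In N.sink => u e) =
      Matrix.vecMul x 𝒞.globalMatrix + Matrix.vecMul z 𝒞.G := by
  have h1 : Matrix.vecMul u (1 - 𝒞.K) = Matrix.vecMul x 𝒞.B + z := by
    rw [Matrix.vecMul_sub, Matrix.vecMul_one]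
    funext e
    have := h e
    simp only [Pi.sub_apply, Pi.add_apply, Matrix.vecMul, dotProduct]
    rw [sub_eq_iff_eq_add, this]
    ring
  have h2 : u = Matrix.vecMul (Matrix.vecMul x 𝒞.B + z) (1 - 𝒞.K)⁻¹ := by
    rw [← h1, Matrix.vecMul_vecMul,
      Matrix.mul_nonsing_inv _ ((Matrix.isUnit_iff_isUnit_det _).mp 𝒞.isUnit_one_sub_K),
      Matrix.vecMul_one]
  rw [globalMatrix, ← Matrix.vecMul_vecMul, ← Matrix.add_vecMul]
  funext e
  exact congrFun h2 e

/-- The code enables the sink to compute `f(x) = x T` with rate `k`. -/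
def Computes (T : Matrix (Fin s) (Fin l) F) : Prop :=
  ∃ φ : (N.In N.sink → F) → (Fin l × Fin k → F), ∀ x : Fin s × Fin k → F,
    φ (Matrix.vecMul x 𝒞.globalMatrix) = Matrix.vecMul x (targetMatrix T k)

/-- `Φ`. -/
def Phi (T : Matrix (Fin s) (Fin l) F) : Set (N.In N.sink → F) :=
  {y | ∃ x : Fin s × Fin k → F, Matrix.vecMul x (targetMatrix T k) ≠ 0 ∧
    y = Matrix.vecMul x 𝒞.globalMatrix}

/-- `Δ(ρ)`. -/
def Delta (ρ : Finset E) : Set (N.In N.sink → F) :=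
  {y | ∃ z : E → F, (∀ e, e ∉ ρ → z e = 0) ∧ y = Matrix.vecMul z 𝒞.G}

/-- The minimum distance `d_min(𝒞, T, k)`. -/
noncomputable def minDist (T : Matrix (Fin s) (Fin l) F) : ℕ :=
  sInf {m | ∃ ρ : Finset E, (𝒞.Phi T ∩ 𝒞.Delta ρ).Nonempty ∧ ρ.card = m}

end LinearCode

variable [Fintype E] [DecidableEq E] (F : Type*) [Field F]

/-- `ρ'` dominates `ρ`: `Δ(ρ) ⊆ Δ(ρ')` for every linear network code over `F`. -/
def Dominated (ρ ρ' : Finset E) : Prop :=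
  ∀ (k : ℕ) (𝒞 : N.LinearCode F k), 𝒞.Delta ρ ⊆ 𝒞.Delta ρ'

/-- The rank of an error pattern. -/
noncomputable def patternRank (ρ : Finset E) : ℕ :=
  sInf {m | ∃ ρ' : Finset E, N.Dominated F ρ ρ' ∧ ρ'.card = m}

/-- `R(δ)`: the error patterns of size and rank `δ`. -/
def fullRankPatterns (δ : ℕ) : Set (Finset E) :=
  {ρ | ρ.card = δ ∧ N.patternRank F ρ = δ}

end AcyclicNetwork

/-! Let `k` imaginary links enter each source. A code is then one matrix `M` on all links, supported
on the acyclic relation `Feeds`. The minimum distance exceeds `δ` once `xF = zG` forces `x = 0` for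
every `z` supported on at most `δ` links. Each such pattern is dominated by one in `R(δ)`
(`exists_mem_fullRankPatterns`), so only the patterns of `R(δ)` need care.

For `ρ` in `R(δ)`, Menger's theorem gives disjoint paths from the imaginary links and `ρ` into the
links of the sink: the rank of `ρ` and the cut condition exclude small separators
(`exists_isLinking_startLinks`). Such a linking, with links off the paths fixed, matches the rows of
`1 - M` off the sink to columns off the start links, so these rows can be made independent. Build
`M` column by column along the acyclic order: each linking forbids at most the zeros of one linear
functional of the new column, and `q` functionals can be avoided at once. Hence `q ≥ |R(δ)|`
suffices (`exists_matrix_of_linkings`).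

Conversely, errors on a cut `C` attaining the minimum simulate all messages of `I_C`, and a
pigeonhole argument confines the errors for some nonzero message to `δ + 1` links
(`LinearCode.exists_pattern_of_cut`). -/

/-! ### Avoiding the zeros of linear functionals -/

/-- In a vector space over a finite field `K`, at most `|K|` nonzero linear functionals are
simultaneously nonzero at some vector. -/
theorem Submodule.exists_mem_forall_ne_zero_of_card_le {K M ι : Type*} [Field K] [Fintype K]
    [AddCommGroup M] [Module K M] (W : Submodule K M) (ℓ : ι → M →ₗ[K] K) (J : Finset ι)
    (hJ : J.card ≤ Fintype.card K) (h : ∀ i ∈ J, ∃ c ∈ W, ℓ i c ≠ 0) :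
    ∃ c ∈ W, ∀ i ∈ J, ℓ i c ≠ 0 := by
  classical
  induction J using Finset.induction_on with
  | empty => exact ⟨0, W.zero_mem, by simp⟩
  | insert j J hj ih =>
    rw [Finset.card_insert_of_notMem hj] at hJ
    obtain ⟨x, hxW, hx⟩ := ih (by omega) fun i hi => h i (Finset.mem_insert_of_mem hi)
    by_cases hjx : ℓ j x = 0
    · obtain ⟨y, hyW, hy⟩ := h j (Finset.mem_insert_self _ _)
      -- On the line `y + t • x` the functional `ℓ j` is constant and nonzero. Only the members of
      -- `J`, fewer than `|K|`, exclude a value of `t`, one each.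
      obtain ⟨t, -, ht⟩ := Finset.exists_mem_notMem_of_card_lt_card
        (s := J.image fun i => -(ℓ i y / ℓ i x)) (t := Finset.univ)
        (lt_of_le_of_lt Finset.card_image_le (by rw [Finset.card_univ]; omega))
      refine ⟨y + t • x, W.add_mem hyW (W.smul_mem _ hxW), fun i hi => ?_⟩
      rcases Finset.mem_insert.mp hi with rfl | hi
      · simpa [hjx] using hy
      · intro h0
        apply ht
        refine Finset.mem_image.mpr ⟨i, hi, ?_⟩
        have := hx i hi
        simp only [map_add, map_smul, smul_eq_mul] at h0
        field_simp
        linear_combination -h0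
    · refine ⟨x, hxW, fun i hi => ?_⟩
      rcases Finset.mem_insert.mp hi with rfl | hi
      · exact hjx
      · exact hx i hi

/-! ### Linkings and Menger's theorem -/

/-- A linking of `A` into `T` along `r`, in matching form: iterating `f` from the elements of `A`
gives disjoint paths from `A` to `T`. -/
structure IsLinking {X : Type*} (r : X → X → Prop) (T A : Finset X) (f : X → X) : Prop where
  injOn : ∀ v ∉ T, ∀ w ∉ T, f v = f w → v = w
  notMem : ∀ v ∉ T, f v ∉ A
  eq_or_rel : ∀ v ∉ T, f v = v ∨ r v (f v)

/-- Menger's theorem: `S ∪ C` contains `A` and can only be left through `C`. -/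
theorem exists_isLinking {X : Type*} [Fintype X] (r : X → X → Prop) (T A : Finset X)
    (h : ∀ S C : Finset X, Disjoint S T → (∀ v ∈ A, v ∈ S ∨ v ∈ C) →
      (∀ v ∈ S, ∀ w, r v w → w ∈ S ∨ w ∈ C) → A.card ≤ C.card) :
    ∃ f, IsLinking r T A f := by
  classical
  let t : {v // v ∉ T} → Finset X := fun v =>
    (Finset.univ.filter fun w => w = v ∨ r v w) \ A
  -- Hall's condition: if `U` collects `A`, `S` and all successors of `S`, then `U \ S` separates,
  -- so `|A| ≤ |U| - |S|`, while `U \ A` lies in the union of the `t v`.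
  have hall : ∀ S : Finset {v // v ∉ T}, S.card ≤ (S.biUnion t).card := by
    intro S
    let S' : Finset X := S.image Subtype.val
    let U : Finset X := A ∪ S' ∪ Finset.univ.filter fun w => ∃ v ∈ S', r v w
    have hS' : S'.card = S.card := Finset.card_image_of_injective _ Subtype.val_injective
    have hSU : S' ⊆ U := fun x hx => by simp only [U, Finset.mem_union]; tauto
    have hAU : A ⊆ U := fun x hx => by simp only [U, Finset.mem_union]; tauto
    have h1 := h S' (U \ S') (by
        rw [Finset.disjoint_left]
        intro a ha
        obtain ⟨b, -, rfl⟩ := Finset.mem_image.mp ha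
        exact b.2)
      (fun v hv => by
        by_cases hvS : v ∈ S'
        · exact Or.inl hvS
        · exact Or.inr (Finset.mem_sdiff.mpr ⟨hAU hv, hvS⟩))
      (fun v hv w hw => by
        by_cases hwS : w ∈ S'
        · exact Or.inl hwS
        · refine Or.inr (Finset.mem_sdiff.mpr ⟨?_, hwS⟩)
          simp only [U, Finset.mem_union, Finset.mem_filter, Finset.mem_univ, true_and]
          exact Or.inr ⟨v, hv, hw⟩)
    have h2 : U \ A ⊆ S.biUnion t := by
      intro x hx
      simp only [U, Finset.mem_sdiff, Finset.mem_union, Finset.mem_filter, Finset.mem_univ,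
        true_and] at hx
      obtain ⟨(hx | hx) | ⟨v, hv, hvx⟩, hxA⟩ := hx
      · exact absurd hx hxA
      · obtain ⟨b, hb, rfl⟩ := Finset.mem_image.mp hx
        exact Finset.mem_biUnion.mpr ⟨b, hb, by simp [t, hxA]⟩
      · obtain ⟨b, hb, rfl⟩ := Finset.mem_image.mp hv
        exact Finset.mem_biUnion.mpr ⟨b, hb, by simp [t, hxA, hvx]⟩
    have h3 := Finset.card_le_card h2
    rw [Finset.card_sdiff_of_subset hAU] at h3
    rw [Finset.card_sdiff_of_subset hSU] at h1
    have h4 := Finset.card_le_card hSU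
    have h5 := Finset.card_le_card hAU
    omega
  obtain ⟨g, hg, hgt⟩ := (Finset.all_card_le_biUnion_card_iff_exists_injective t).mp hall
  refine ⟨fun v => if hv : v ∉ T then g ⟨v, hv⟩ else v, ?_, ?_, ?_⟩
  · intro v hv w hw hvw
    simp only [dif_pos hv, dif_pos hw] at hvw
    exact congrArg Subtype.val (hg hvw)
  · intro v hv
    have := hgt ⟨v, hv⟩
    simp only [dif_pos hv]
    exact (Finset.mem_sdiff.mp this).2
  · intro v hv
    have := hgt ⟨v, hv⟩
    simp only [dif_pos hv]
    simpa [t] using (Finset.mem_sdiff.mp this).1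

/-- A linking of `A` extends to a linking of any larger set of at most `|T|` elements. -/
theorem IsLinking.exists_superset {X : Type*} [Fintype X] {r : X → X → Prop}
    {T A : Finset X} {f : X → X} (hf : IsLinking r T A f) {n : ℕ} (hAn : A.card ≤ n)
    (hn : n ≤ T.card) : ∃ A', A ⊆ A' ∧ A'.card = n ∧ IsLinking r T A' f := by
  classical
  -- Exactly `|T|` elements are not values of `f` off `T`, and `f` links any set of them.
  have hA : A ⊆ (Tᶜ.image f)ᶜ := by
    intro a ha
    simp only [Finset.mem_compl, Finset.mem_image, not_exists, not_and]
    rintro v hv rfl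
    exact hf.notMem v hv ha
  have hc : (Tᶜ.image f)ᶜ.card = T.card := by
    rw [Finset.card_compl, Finset.card_image_of_injOn, ← Finset.card_compl, compl_compl]
    intro v hv w hw
    simp only [Finset.coe_compl, Set.mem_compl_iff, Finset.mem_coe] at hv hw
    exact hf.injOn v hv w hw
  obtain ⟨A', h1, h2, h3⟩ := Finset.exists_subsuperset_card_eq hA hAn (hc ▸ hn)
  refine ⟨A', h1, h3, hf.injOn, fun v hv hvA => ?_, hf.eq_or_rel⟩
  have := h2 hvA
  simp only [Finset.mem_compl, Finset.mem_image, not_exists, not_and] at this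
  exact this v hv rfl

/-! ### One matrix for many linkings -/

section Coding

open Finset

variable {X F : Type*} [Fintype X] [DecidableEq X] [Field F]

/-- The rows of `1 - M` in `P` whose image under `f` is in `P` are linearly independent on the
columns in `P \ A`. -/
def IndepOn (T A : Finset X) (f : X → X) (P : Finset X) (M : Matrix X X F) : Prop :=
  ∀ w : X → F, (∀ v, w v ≠ 0 → v ∈ P ∧ v ∉ T ∧ f v ∈ P) →
    (∀ e ∈ P, e ∉ A → w e = ∑ d, w d * M d e) → w = 0

/-- Passing from `P` to `insert e P`, a linking forbids the zeros of at most one linear functional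
for the new column of `M`. -/
theorem IsLinking.indepOn_insert {r : X → X → Prop} {T A : Finset X} {f : X → X}
    (hf : IsLinking r T A f) (hr : ∀ v, ¬ r v v) {P : Finset X} {e : X} (he : e ∉ P)
    (hP : ∀ v ∈ P, ¬ r e v) (hPe : ∀ v, r v e → v ∈ P) {M : Matrix X X F}
    (hM : ∀ d e, ¬ r d e → M d e = 0) (hI : IndepOn T A f P M) :
    (∀ c : X → F, (∀ d, ¬ r d e → c d = 0) →
      IndepOn T A f (insert e P) (M.updateCol e c)) ∨
    ∃ ℓ : (X → F) →ₗ[F] F, (∃ c, (∀ d, ¬ r d e → c d = 0) ∧ ℓ c ≠ 0) ∧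
      ∀ c : X → F, (∀ d, ¬ r d e → c d = 0) → ℓ c ≠ 0 →
        IndepOn T A f (insert e P) (M.updateCol e c) := by
  have hfe : e ∉ T → f e ∈ insert e P → f e = e := by
    intro heT hfe
    rcases mem_insert.mp hfe with h | h
    · exact h
    · rcases hf.eq_or_rel e heT with h' | h'
      · exact h'
      · exact absurd h' (hP _ h)
  have hcol : ∀ (c w : X → F), ∀ e' ∈ P,
      ∑ d, w d * M.updateCol e c d e' = ∑ d, w d * M d e' := by
    intro c w e' he'
    refine sum_congr rfl fun d _ => ?_
    rw [Matrix.updateCol_ne]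
    rintro rfl
    exact he he'
  -- Every row gained is matched to `e`, so by injectivity there is at most one: some `v0 ≠ e`, or
  -- `e` itself.
  by_cases hv0 : ∃ v0, v0 ∉ T ∧ v0 ≠ e ∧ f v0 = e
  · obtain ⟨v0, hv0T, hv0e, hfv0⟩ := hv0
    have hrv0 : r v0 e := by
      rcases hf.eq_or_rel v0 hv0T with h | h
      · exact absurd (h.symm.trans hfv0) hv0e
      · rwa [hfv0] at h
    have heA : e ∉ A := hfv0 ▸ hf.notMem v0 hv0T
    have hwe : ∀ w : X → F, (∀ v, w v ≠ 0 → v ∈ insert e P ∧ v ∉ T ∧ f v ∈ insert e P) →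
        w e = 0 := by
      intro w hw
      by_contra h
      obtain ⟨-, h2, h3⟩ := hw e h
      exact hv0e (hf.injOn _ hv0T _ h2 (hfv0.trans (hfe h2 h3).symm))
    have hsmall : ∀ w : X → F, (∀ v, w v ≠ 0 → v ∈ insert e P ∧ v ∉ T ∧ f v ∈ insert e P) →
        (∀ e' ∈ P, e' ∉ A → w e' = ∑ d, w d * M d e') → w v0 = 0 → w = 0 := by
      intro w hw heq h0
      refine hI w (fun v hv => ?_) heq
      obtain ⟨h1, h2, h3⟩ := hw v hv
      refine ⟨mem_of_mem_insert_of_ne h1 ?_, h2, mem_of_mem_insert_of_ne h3 ?_⟩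
      · rintro rfl
        exact hv (hwe w hw)
      · intro h
        rw [hf.injOn _ h2 _ hv0T (h.trans hfv0.symm)] at hv
        exact hv h0
    -- The solutions of the old equations form at most a line, as `w v0` determines them. If `w0`
    -- spans it, then `w0 e = 0`, so the new equation at `e` kills `w0` exactly when `∑ d, w0 d * c
    -- d ≠ 0`.
    by_cases hw0 : ∃ w0 : X → F, w0 v0 ≠ 0 ∧
        (∀ v, w0 v ≠ 0 → v ∈ insert e P ∧ v ∉ T ∧ f v ∈ insert e P) ∧
        (∀ e' ∈ P, e' ∉ A → w0 e' = ∑ d, w0 d * M d e')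
    · obtain ⟨w0, hw0v, hw0s, hw0q⟩ := hw0
      refine Or.inr ⟨∑ d, w0 d • LinearMap.proj d, ⟨Pi.single v0 1, fun d hd => ?_, ?_⟩, ?_⟩
      · rw [Pi.single_eq_of_ne]
        rintro rfl
        exact hd hrv0
      · simpa [LinearMap.sum_apply, Pi.single_apply] using hw0v
      · intro c hc hℓ w hw heq
        set a := w v0 / w0 v0 with ha
        have hw' : w - a • w0 = 0 := by
          refine hsmall _ (fun v hv => ?_) (fun e' he' he'A => ?_) ?_
          · by_cases h : w v = 0
            · refine hw0s v fun h' => hv ?_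
              simp [h, h']
            · exact hw v h
          · have h1 := heq e' (mem_insert_of_mem he') he'A
            rw [hcol c w e' he'] at h1
            simp only [Pi.sub_apply, Pi.smul_apply, smul_eq_mul, sub_mul, sum_sub_distrib,
              mul_assoc, ← mul_sum]
            rw [← h1, ← hw0q e' he' he'A]
          · simp [ha, hw0v]
        rw [sub_eq_zero] at hw'
        have h1 := heq e (mem_insert_self _ _) heA
        rw [hwe w hw] at h1
        have h2 : a = 0 := by
          have : a * ∑ d, w0 d * c d = 0 := by
            rw [h1, mul_sum]
            refine sum_congr rfl fun d _ => ?_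
            rw [Matrix.updateCol_self, hw', Pi.smul_apply, smul_eq_mul, mul_assoc]
          refine (mul_eq_zero.mp this).resolve_right ?_
          simpa [LinearMap.sum_apply] using hℓ
        rw [hw', h2, zero_smul]
    · refine Or.inl fun c hc w hw heq => ?_
      have heq' : ∀ e' ∈ P, e' ∉ A → w e' = ∑ d, w d * M d e' := fun e' he' he'A => by
        rw [heq e' (mem_insert_of_mem he') he'A, hcol c w e' he']
      refine hsmall w hw heq' ?_
      by_contra h
      exact hw0 ⟨w, h, hw, heq'⟩
  · push Not at hv0
    refine Or.inl fun c hc w hw heq => ?_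
    -- Row `e` is invisible to the old columns, and its diagonal entry in `1 - M` stays `1` whatever
    -- `c` is.
    have hw' : Function.update w e 0 = 0 := by
      refine hI _ (fun v hv => ?_) (fun e' he' he'A => ?_)
      · have hve : v ≠ e := by
          rintro rfl
          simp at hv
        rw [Function.update_of_ne hve] at hv
        obtain ⟨h1, h2, h3⟩ := hw v hv
        exact ⟨mem_of_mem_insert_of_ne h1 hve, h2, mem_of_mem_insert_of_ne h3 (hv0 v h2 hve)⟩
      · have hne : e' ≠ e := by
          rintro rfl
          exact he he'
        rw [Function.update_of_ne hne, heq e' (mem_insert_of_mem he') he'A, hcol c w e' he']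
        refine sum_congr rfl fun d _ => ?_
        by_cases hd : d = e
        · rw [hd, hM e e' (hP e' he')]; simp
        · rw [Function.update_of_ne hd]
    have hwd : ∀ d, d ≠ e → w d = 0 := fun d hd => by
      simpa [Function.update_of_ne hd] using congrFun hw' d
    have hwe : w e = 0 := by
      by_contra h
      obtain ⟨-, h2, h3⟩ := hw e h
      have heA : e ∉ A := hfe h2 h3 ▸ hf.notMem e h2
      apply h
      rw [heq e (mem_insert_self _ _) heA]
      refine sum_eq_zero fun d _ => ?_
      by_cases hd : d = e
      · rw [hd, Matrix.updateCol_self, hc e (hr e), mul_zero]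
      · rw [hwd d hd, zero_mul]
    funext d
    by_cases hd : d = e
    · rw [hd, hwe]; rfl
    · exact hwd d hd

/-- If `F` has at least as many elements as the family of linkings has members, then one matrix
supported on the acyclic relation `r` realizes all the linkings at once. -/
theorem exists_matrix_of_linkings [Fintype F] {ι : Type*} [Fintype ι] {r : X → X → Prop}
    (hr : ∀ v, ¬ Relation.TransGen r v v) (T : Finset X) (A : ι → Finset X) (f : ι → X → X)
    (hf : ∀ i, IsLinking r T (A i) (f i)) (hι : Fintype.card ι ≤ Fintype.card F) :
    ∃ M : Matrix X X F, (∀ d e, ¬ r d e → M d e = 0) ∧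
      ∀ i, ∀ w : X → F, (∀ v ∈ T, w v = 0) → (∀ e ∉ A i, w e = ∑ d, w d * M d e) → w = 0 := by
  classical
  have hwf : WellFounded (fun a b => Relation.TransGen r b a) := by
    have : Std.Irrefl (fun a b => Relation.TransGen r b a) := ⟨hr⟩
    have : IsTrans X (fun a b => Relation.TransGen r b a) := ⟨fun _ _ _ h h' => h'.trans h⟩
    exact Finite.wellFounded_of_trans_of_irrefl _
  suffices H : ∀ n (P : Finset X), P.card = n → (∀ d e, r d e → e ∈ P → d ∈ P) →
      ∃ M : Matrix X X F, (∀ d e, ¬ r d e → M d e = 0) ∧ ∀ i, IndepOn T (A i) (f i) P M by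
    obtain ⟨M, hM, hI⟩ := H _ univ rfl fun _ _ _ _ => mem_univ _
    refine ⟨M, hM, fun i w hw heq => hI i w (fun v hv => ?_) fun e _ => heq e⟩
    exact ⟨mem_univ _, fun h => hv (hw v h), mem_univ _⟩
  intro n
  induction n with
  | zero =>
    intro P hP _
    rw [card_eq_zero] at hP
    subst hP
    refine ⟨0, fun _ _ _ => rfl, fun i w hw _ => ?_⟩
    funext v
    by_contra h
    exact absurd (hw v h).1 (notMem_empty _)
  | succ n ih =>
    intro Q hQ hdown
    -- A last element of `Q`: it feeds nothing in `Q`, so its column can be chosen after all others.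
    obtain ⟨e, heQ, hmax⟩ := hwf.has_min (Q : Set X)
      (Finset.coe_nonempty.mpr (card_pos.mp (by omega)))
    have hQe : insert e (Q.erase e) = Q := insert_erase heQ
    have hP : ∀ v ∈ Q.erase e, ¬ r e v := fun v hv h =>
      hmax v (mem_of_mem_erase hv) (Relation.TransGen.single h)
    have hirr : ∀ v, ¬ r v v := fun v h => hr v (Relation.TransGen.single h)
    obtain ⟨M, hM, hI⟩ := ih (Q.erase e) (by rw [card_erase_of_mem heQ]; omega) (by
      intro d e' hde he'
      refine mem_erase.mpr ⟨?_, hdown d e' hde (mem_of_mem_erase he')⟩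
      rintro rfl
      exact hP e' he' hde)
    have hPe : ∀ v, r v e → v ∈ Q.erase e := fun v hv =>
      mem_erase.mpr ⟨fun h => hirr e (h ▸ hv), hdown v e hv heQ⟩
    have key := fun i =>
      (hf i).indepOn_insert hirr (notMem_erase e Q) hP hPe hM (hI i)
    rw [hQe] at key
    -- The linkings that really constrain the new column.
    let J : Finset ι := univ.filter fun i => ¬ ∀ c : X → F, (∀ d, ¬ r d e → c d = 0) →
      IndepOn T (A i) (f i) Q (M.updateCol e c)
    have key' : ∀ i, ∃ ℓ : (X → F) →ₗ[F] F, i ∈ J →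
        (∃ c, (∀ d, ¬ r d e → c d = 0) ∧ ℓ c ≠ 0) ∧
        ∀ c : X → F, (∀ d, ¬ r d e → c d = 0) → ℓ c ≠ 0 →
        IndepOn T (A i) (f i) Q (M.updateCol e c) := by
      intro i
      rcases key i with h | ⟨ℓ, h⟩
      · exact ⟨0, fun hi => absurd h (mem_filter.mp hi).2⟩
      · exact ⟨ℓ, fun _ => h⟩
    choose ℓ hℓ using key'
    let W : Submodule F (X → F) :=
      { carrier := {c | ∀ d, ¬ r d e → c d = 0}
        add_mem' := fun ha hb d hd => by simp [ha d hd, hb d hd]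
        zero_mem' := fun _ _ => rfl
        smul_mem' := fun a c hc d hd => by simp [hc d hd] }
    obtain ⟨c, hc, hcJ⟩ := W.exists_mem_forall_ne_zero_of_card_le ℓ J
      ((card_le_univ J).trans hι) fun i hi => (hℓ i hi).1
    refine ⟨M.updateCol e c, fun d e' hde => ?_, fun i => ?_⟩
    · by_cases h : e' = e
      · subst h
        rw [Matrix.updateCol_self]
        exact hc d hde
      · rw [Matrix.updateCol_ne h]
        exact hM d e' hde
    · by_cases hi : i ∈ J
      · exact (hℓ i hi).2 c hc (hcJ i hi)
      · simp only [J, mem_filter, mem_univ, true_and, not_not] at hi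
        exact hi c hc

end Coding

/-! ### The acyclic relation on links -/

namespace AcyclicNetwork

variable {V E : Type*} {s : ℕ} (N : AcyclicNetwork V E s)

/-- The links of the network with `k` imaginary links entering each source: `N.Feeds k d e` says
that the symbol carried by `d` is available where `e` starts. -/
inductive Feeds (k : ℕ) : (Fin s × Fin k) ⊕ E → (Fin s × Fin k) ⊕ E → Prop
  | source (i : Fin s) (j : Fin k) (e : E) (h : N.tail e = N.source i) :
      Feeds k (Sum.inl (i, j)) (Sum.inr e)
  | link (d e : E) (h : N.tail e = N.head d) : Feeds k (Sum.inr d) (Sum.inr e)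

/-- Nothing feeds an imaginary link, so a cycle of `Feeds` would run through genuine links and give
a closed directed path. -/
theorem exists_isDirPath_of_transGen_feeds {k : ℕ} {a b : (Fin s × Fin k) ⊕ E}
    (h : Relation.TransGen (N.Feeds k) a b) :
    ∃ e, b = Sum.inr e ∧ ∀ d, a = Sum.inr d →
      ∃ p, IsDirPath N.tail N.head (N.tail d) (N.tail e) p := by
  induction h with
  | single h =>
    cases h with
    | source i j e h => exact ⟨e, rfl, by simp⟩
    | link d e h =>
      exact ⟨e, rfl, fun d' hd' => by cases hd'; exact ⟨[d], by simp, rfl, h.symm, by simp⟩⟩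
  | @tail b c _ hbc ih =>
    obtain ⟨e, rfl, ih⟩ := ih
    cases hbc with
    | link _ e' h =>
      refine ⟨e', rfl, fun d hd => ?_⟩
      obtain ⟨p, hp, h1, h2, h3⟩ := ih d hd
      refine ⟨p ++ [e], by simp, ?_, by simpa using h.symm, ?_⟩
      · rw [List.head_append_of_ne_nil hp]; exact h1
      · rw [List.isChain_append]
        refine ⟨h3, by simp, ?_⟩
        intro x hx y hy
        rw [List.getLast?_eq_getLast_of_ne_nil hp] at hx
        simp only [Option.mem_def, Option.some.injEq, List.head?_cons] at hx hy
        subst hx; subst hy; exact h2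

theorem not_transGen_feeds_self {k : ℕ} (a : (Fin s × Fin k) ⊕ E) :
    ¬ Relation.TransGen (N.Feeds k) a a := by
  intro h
  obtain ⟨e, rfl, he⟩ := N.exists_isDirPath_of_transGen_feeds h
  obtain ⟨p, hp⟩ := he e rfl
  exact N.acyclic _ p hp

/-- Every path to the sink that starts with a link of `S` meets `C`, if `S` has no link into the
sink and can only be left through `C`. -/
theorem exists_mem_of_isDirPath {S C : Finset E} (hS : ∀ e ∈ S, N.head e ≠ N.sink)
    (hSC : ∀ d ∈ S, ∀ e, N.tail e = N.head d → e ∈ S ∨ e ∈ C) {u : V} {p : List E}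
    (hp : IsDirPath N.tail N.head u N.sink p) (hu : ∀ e, N.tail e = u → e ∈ S ∨ e ∈ C) :
    ∃ e ∈ p, e ∈ C := by
  obtain ⟨hne, h1, h2, h3⟩ := hp
  induction p generalizing u with
  | nil => exact absurd rfl hne
  | cons a p ih =>
    rcases hu a h1 with ha | ha
    · rcases p with _ | ⟨b, p⟩
      · exact absurd h2 (hS a ha)
      · rw [List.isChain_cons_cons] at h3
        obtain ⟨e, he, heC⟩ := ih (hSC a ha) (by simp) h3.1.symm (by simpa using h2) h3.2
        exact ⟨e, List.mem_cons_of_mem _ he, heC⟩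
    · exact ⟨a, by simp, ha⟩

theorem isDirPath_cons {e : E} {p : List E} {v : V}
    (hp : IsDirPath N.tail N.head (N.head e) v p) :
    IsDirPath N.tail N.head (N.tail e) v (e :: p) := by
  obtain ⟨hne, h1, h2, h3⟩ := hp
  refine ⟨by simp, rfl, by rwa [List.getLast_cons hne], ?_⟩
  obtain ⟨b, p, rfl⟩ := List.exists_cons_of_ne_nil hne
  rw [List.isChain_cons_cons]
  exact ⟨h1.symm, h3⟩

section Fintype

variable [Fintype E]

/-- `In(γ)` as a finset. -/
noncomputable def sinkLinks : Finset E := by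
  classical exact Finset.univ.filter fun e => N.head e = N.sink

@[simp] theorem mem_sinkLinks {e : E} : e ∈ N.sinkLinks ↔ N.head e = N.sink := by
  classical
  simp [sinkLinks]

variable [DecidableEq E]

/-! ### Simulating errors and messages on a separating set -/

namespace LinearCode

variable {N} {F : Type*} [Field F] {k : ℕ} (𝒞 : N.LinearCode F k)

theorem mem_Delta_iff_mem_span {ρ : Finset E} (y : N.In N.sink → F) :
    y ∈ 𝒞.Delta ρ ↔ y ∈ Submodule.span F (𝒞.G '' (ρ : Set E)) := by
  constructor
  · rintro ⟨z, hz, rfl⟩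
    rw [Matrix.vecMul_eq_sum]
    refine Submodule.sum_mem _ fun e _ => ?_
    by_cases he : e ∈ ρ
    · exact Submodule.smul_mem _ _ (Submodule.subset_span ⟨e, he, rfl⟩)
    · rw [hz e he, zero_smul]; exact Submodule.zero_mem _
  · intro h
    induction h using Submodule.span_induction with
    | mem y hy =>
      obtain ⟨e, he, rfl⟩ := hy
      refine ⟨Pi.single e 1, fun d hd => ?_, ?_⟩
      · rw [Pi.single_eq_of_ne]
        rintro rfl
        exact hd he
      · rw [Matrix.single_one_vecMul]; rfl
    | zero => exact ⟨0, fun _ _ => rfl, by simp⟩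
    | add x y _ _ hx hy =>
      obtain ⟨a, ha, rfl⟩ := hx
      obtain ⟨b, hb, rfl⟩ := hy
      exact ⟨a + b, fun e he => by simp [ha e he, hb e he], by rw [Matrix.add_vecMul]⟩
    | smul c x _ hx =>
      obtain ⟨a, ha, rfl⟩ := hx
      exact ⟨c • a, fun e he => by simp [ha e he], by rw [Matrix.smul_vecMul]⟩

/-- By row `e` of `(1 - K)(1 - K)⁻¹ = 1`, an error on a link not entering the sink acts only through
the links that leave its head. -/
theorem G_mem_of_notMem_sink {e : E} (he : N.head e ≠ N.sink)
    {W : Submodule F (N.In N.sink → F)} (hW : ∀ d, N.tail d = N.head e → 𝒞.G d ∈ W) :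
    𝒞.G e ∈ W := by
  have h1 : (1 - 𝒞.K) * (1 - 𝒞.K)⁻¹ = 1 :=
    Matrix.mul_nonsing_inv _ ((Matrix.isUnit_iff_isUnit_det _).mp 𝒞.isUnit_one_sub_K)
  have h2 : 𝒞.G e = ∑ d, 𝒞.K e d • 𝒞.G d := by
    funext t
    have h3 := congrFun (congrFun h1 e) t.1
    rw [Matrix.sub_mul, Matrix.one_mul, Matrix.sub_apply, Matrix.one_apply_ne, sub_eq_zero] at h3
    · simpa [G, Matrix.mul_apply] using h3
    · rintro rfl
      exact he t.2
  rw [h2]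
  refine W.sum_mem fun d _ => ?_
  by_cases hd : N.tail d = N.head e
  · exact W.smul_mem _ (hW d hd)
  · rw [𝒞.K_eq_zero e d hd, zero_smul]; exact W.zero_mem

/-- If `S` has no link into the sink and can only be left through `C`, then errors on `S` can be
simulated on `C`. -/
theorem G_mem_of_mem {S C : Finset E} (hS : ∀ e ∈ S, N.head e ≠ N.sink)
    (hSC : ∀ d ∈ S, ∀ e, N.tail e = N.head d → e ∈ S ∨ e ∈ C) {e : E} (he : e ∈ S ∨ e ∈ C) :
    𝒞.G e ∈ Submodule.span F (𝒞.G '' (C : Set E)) := by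
  -- With `k = 0` there are no imaginary links; the induction runs backwards, from links that feed
  -- nothing.
  have hwf : WellFounded (fun a b : (Fin s × Fin 0) ⊕ E =>
      Relation.TransGen (N.Feeds 0) b a) := by
    have : Std.Irrefl (fun a b => Relation.TransGen (N.Feeds 0) b a) :=
      ⟨N.not_transGen_feeds_self⟩
    have : IsTrans _ (fun a b => Relation.TransGen (N.Feeds 0) b a) :=
      ⟨fun _ _ _ h h' => h'.trans h⟩
    exact Finite.wellFounded_of_trans_of_irrefl _
  suffices H : ∀ a : (Fin s × Fin 0) ⊕ E, ∀ e, a = Sum.inr e → (e ∈ S ∨ e ∈ C) →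
      𝒞.G e ∈ Submodule.span F (𝒞.G '' (C : Set E)) from H _ e rfl he
  intro a
  induction a using hwf.induction with
  | _ a ih =>
    rintro e rfl (he | he)
    · refine 𝒞.G_mem_of_notMem_sink (hS e he) fun d hd => ?_
      exact ih (Sum.inr d) (Relation.TransGen.single (Feeds.link e d hd)) d rfl (hSC e he d hd)
    · exact Submodule.subset_span ⟨e, he, rfl⟩

/-- A link leaving a source of `I_C` is in `C` or leads to the sink only through `C`, so its
contribution lies in the span of the rows of `G` indexed by `C`. -/
theorem exists_simulation_of_mem_cutSources {C : Finset E} {x : Fin s × Fin k → F}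
    (hx : ∀ i j, i ∉ N.cutSources C → x (i, j) = 0) :
    Matrix.vecMul x 𝒞.globalMatrix ∈ 𝒞.Delta C := by
  classical
  rw [mem_Delta_iff_mem_span]
  -- The links outside `C` from which every way on to the sink meets `C`; the case `p = []` excludes
  -- links into the sink.
  let S : Finset E := Finset.univ.filter fun e => e ∉ C ∧
    ∀ p, IsDirPath N.tail N.head (N.tail e) N.sink (e :: p) → ∃ d ∈ p, d ∈ C
  have hS : ∀ e ∈ S, N.head e ≠ N.sink := by
    intro e he h
    obtain ⟨d, hd, -⟩ := (Finset.mem_filter.mp he).2.2 [] ⟨by simp, rfl, h, by simp⟩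
    simp at hd
  have hSC : ∀ d ∈ S, ∀ e, N.tail e = N.head d → e ∈ S ∨ e ∈ C := by
    intro d hd e hed
    by_cases heC : e ∈ C
    · exact Or.inr heC
    · refine Or.inl (Finset.mem_filter.mpr ⟨Finset.mem_univ _, heC, fun p hp => ?_⟩)
      rw [hed] at hp
      obtain ⟨c, hc, hcC⟩ := (Finset.mem_filter.mp hd).2.2 _ (N.isDirPath_cons hp)
      rcases List.mem_cons.mp hc with rfl | hc
      · exact absurd hcC heC
      · exact ⟨c, hc, hcC⟩
  rw [globalMatrix, ← Matrix.vecMul_vecMul, Matrix.vecMul_eq_sum]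
  refine Submodule.sum_mem _ fun e _ => ?_
  by_cases he : e ∈ S ∨ e ∈ C
  · exact Submodule.smul_mem _ _ (𝒞.G_mem_of_mem hS hSC he)
  · have : Matrix.vecMul x 𝒞.B e = 0 := by
      refine Finset.sum_eq_zero fun ij _ => ?_
      obtain ⟨i, j⟩ := ij
      change x (i, j) * 𝒞.B (i, j) e = 0
      by_cases hi : N.tail e = N.source i
      · rw [hx i j, zero_mul]
        intro hic
        push Not at he
        obtain ⟨heS, heC⟩ := he
        simp only [S, Finset.mem_filter, Finset.mem_univ, true_and, not_and, not_forall] at heS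
        obtain ⟨p, hp, hpC⟩ := heS heC
        refine hic ⟨e :: p, hi ▸ hp, fun d hd => ?_⟩
        rcases List.mem_cons.mp hd with rfl | hd
        · exact heC
        · exact fun h => hpC ⟨d, hd, h⟩
      · rw [𝒞.B_eq_zero i j e hi, mul_zero]
    rw [this, zero_smul]
    exact Submodule.zero_mem _

end LinearCode

/-! ### Codes from linkings -/

/-- The imaginary links of the sources together with the links of `ρ`. -/
def startLinks (k : ℕ) (ρ : Finset E) : Finset ((Fin s × Fin k) ⊕ E) :=
  Finset.univ.disjSum ρ

/-- The links into the sink, in the network with `k` imaginary links entering each source. -/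
noncomputable def endLinks (k : ℕ) : Finset ((Fin s × Fin k) ⊕ E) :=
  (∅ : Finset (Fin s × Fin k)).disjSum N.sinkLinks

/-- The blocks of one matrix `M` serve as `B` and `K`. If `xF = zG`, the messages `x` together with
the link symbols they produce under the error `-z` vanish at the sink and satisfy the equations of
`1 - M` off the start links; the linking forces them to be zero. -/
theorem exists_linearCode_of_linkings {F : Type*} [Field F] [Fintype F] {k : ℕ} {ι : Type*}
    [Fintype ι] (ρ : ι → Finset E)
    (hρ : ∀ i, ∃ f, IsLinking (N.Feeds k) (N.endLinks k) (startLinks k (ρ i)) f)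
    (hι : Fintype.card ι ≤ Fintype.card F) :
    ∃ 𝒞 : N.LinearCode F k, ∀ i, ∀ (x : Fin s × Fin k → F) (z : E → F),
      (∀ e ∉ ρ i, z e = 0) → Matrix.vecMul x 𝒞.globalMatrix = Matrix.vecMul z 𝒞.G →
      x = 0 ∧ z = 0 := by
  classical
  choose f hf using hρ
  obtain ⟨M, hM, hMi⟩ := exists_matrix_of_linkings (F := F) N.not_transGen_feeds_self
    (N.endLinks k) _ f hf hι
  let 𝒞 : N.LinearCode F k :=
    { B := fun ij e => M (Sum.inl ij) (Sum.inr e)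
      K := fun d e => M (Sum.inr d) (Sum.inr e)
      B_eq_zero := fun i j e h => hM _ _ fun h' => by cases h'; contradiction
      K_eq_zero := fun d e h => hM _ _ fun h' => by cases h'; contradiction }
  refine ⟨𝒞, fun i x z hz hxz => ?_⟩
  let u : E → F := Matrix.vecMul (Matrix.vecMul x 𝒞.B - z) (1 - 𝒞.K)⁻¹
  have hu : ∀ e, u e = Matrix.vecMul x 𝒞.B e - z e + Matrix.vecMul u 𝒞.K e := by
    have h1 : Matrix.vecMul u (1 - 𝒞.K) = Matrix.vecMul x 𝒞.B - z := by
      rw [Matrix.vecMul_vecMul, Matrix.nonsing_inv_mul _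
        ((Matrix.isUnit_iff_isUnit_det _).mp 𝒞.isUnit_one_sub_K), Matrix.vecMul_one]
    rw [Matrix.vecMul_sub, Matrix.vecMul_one, sub_eq_iff_eq_add] at h1
    exact fun e => congrFun h1 e
  have huT : ∀ e, N.head e = N.sink → u e = 0 := by
    intro e he
    have h1 : Matrix.vecMul (Matrix.vecMul x 𝒞.B - z) 𝒞.G = 0 := by
      rw [Matrix.sub_vecMul, Matrix.vecMul_vecMul, sub_eq_zero]
      exact hxz
    exact congrFun h1 ⟨e, he⟩
  have hw := hMi i (Sum.elim x u) (fun v hv => ?_) (fun e he => ?_)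
  · have hx : x = 0 := funext fun ij => congrFun hw (Sum.inl ij)
    have hu0 : u = 0 := funext fun e => congrFun hw (Sum.inr e)
    refine ⟨hx, funext fun e => ?_⟩
    have := hu e
    rw [hu0, hx] at this
    simpa using this
  · rcases v with ij | e
    · simp [endLinks] at hv
    · exact huT e (by simpa [endLinks] using hv)
  · rcases e with ij | e
    · simp [startLinks] at he
    · have he' : e ∉ ρ i := by simpa [startLinks] using he
      have := hu e
      rw [hz e he', sub_zero] at this
      rw [Fintype.sum_sum_type]
      exact this

/-! ### Rank of error patterns and linkings -/

variable (F : Type*) [Field F]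

theorem patternRank_le {ρ ρ' : Finset E} (h : N.Dominated F ρ ρ') :
    N.patternRank F ρ ≤ ρ'.card :=
  Nat.sInf_le ⟨ρ', h, rfl⟩

theorem exists_dominated_card_eq_patternRank (ρ : Finset E) :
    ∃ ρ', N.Dominated F ρ ρ' ∧ ρ'.card = N.patternRank F ρ :=
  Nat.sInf_mem (s := {m | ∃ ρ' : Finset E, N.Dominated F ρ ρ' ∧ ρ'.card = m})
    ⟨_, ρ, fun _ _ => subset_rfl, rfl⟩

theorem dominated_of_subset {ρ ρ' : Finset E} (h : ρ ⊆ ρ') : N.Dominated F ρ ρ' := by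
  rintro k 𝒞 y ⟨z, hz, rfl⟩
  exact ⟨z, fun e he => hz e fun h' => he (h h'), rfl⟩

/-- If `S ∪ C` contains `ρ`, has no link of `S` into the sink and can only be left through `C`,
then `|C|` is at least the rank of `ρ`. -/
theorem patternRank_le_of_separates {ρ S C : Finset E} (hS : ∀ e ∈ S, N.head e ≠ N.sink)
    (hSC : ∀ d ∈ S, ∀ e, N.tail e = N.head d → e ∈ S ∨ e ∈ C) (hρ : ∀ e ∈ ρ, e ∈ S ∨ e ∈ C) :
    N.patternRank F ρ ≤ C.card := by
  refine N.patternRank_le F fun k 𝒞 y hy => ?_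
  rw [LinearCode.mem_Delta_iff_mem_span] at hy ⊢
  revert y
  change Submodule.span F _ ≤ Submodule.span F _
  rw [Submodule.span_le]
  rintro _ ⟨e, he, rfl⟩
  exact 𝒞.G_mem_of_mem hS hSC (hρ e he)

/-- A pattern of full rank is linked into the sink, disjointly from `k` paths out of each source,
if the cuts of the network allow it. -/
theorem exists_isLinking_startLinks {ρ : Finset E} (hρ : N.patternRank F ρ = ρ.card) {k : ℕ}
    (hcut : 0 < k → ∀ C ∈ N.cuts, ρ.card + k * (N.cutSources C).ncard ≤ C.card) :
    ∃ f, IsLinking (N.Feeds k) (N.endLinks k) (startLinks k ρ) f := by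
  classical
  refine exists_isLinking _ _ _ fun S C hST hA hSC => ?_
  have hS : ∀ e ∈ S.toRight, N.head e ≠ N.sink := by
    intro e he h
    exact Finset.disjoint_left.mp hST (Finset.mem_toRight.mp he) (by simp [endLinks, h])
  have hSCr : ∀ d ∈ S.toRight, ∀ e, N.tail e = N.head d → e ∈ S.toRight ∨ e ∈ C.toRight := by
    intro d hd e hed
    simpa using hSC _ (Finset.mem_toRight.mp hd) _ (Feeds.link d e hed)
  have hρSC : ∀ e ∈ ρ, e ∈ S.toRight ∨ e ∈ C.toRight := fun e he => by
    simpa using hA (Sum.inr e) (by simp [startLinks, he])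
  have h1 := N.patternRank_le_of_separates F hS hSCr hρSC
  rw [hρ] at h1
  have hC : C.card = C.toLeft.card + C.toRight.card := Finset.card_toLeft_add_card_toRight.symm
  have hAc : (startLinks k ρ : Finset ((Fin s × Fin k) ⊕ E)).card = s * k + ρ.card := by
    simp [startLinks, Finset.card_disjSum]
  -- The sources with an imaginary link in `S`. The genuine links of `C` cut each of them off, and
  -- `C` contains all `k` imaginary links of every other source.
  let J : Finset (Fin s) := Finset.univ.filter fun i => ∃ j : Fin k, Sum.inl (i, j) ∈ S
  have hJC : (Jᶜ ×ˢ (Finset.univ : Finset (Fin k))) ⊆ C.toLeft := by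
    rintro ⟨i, j⟩ hij
    have hi : i ∉ J := Finset.mem_compl.mp (Finset.mem_product.mp hij).1
    rw [Finset.mem_toLeft]
    refine (hA (Sum.inl (i, j)) (by simp [startLinks])).resolve_left fun h => hi ?_
    exact Finset.mem_filter.mpr ⟨Finset.mem_univ _, j, h⟩
  have h2 := Finset.card_le_card hJC
  rw [Finset.card_product, Finset.card_compl, Fintype.card_fin, Finset.card_univ,
    Fintype.card_fin, Nat.sub_mul] at h2
  -- For empty `J` the rank bound on `C.toRight` suffices. Otherwise `C.toRight` is a cut, and the
  -- cut condition makes up for the `k|J|` imaginary links that may be missing from `C`.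
  rcases J.eq_empty_or_nonempty with hJ | ⟨i, hi⟩
  · rw [hJ, Finset.card_empty, zero_mul] at h2
    omega
  · have hJcut : ∀ i ∈ J, ∀ p, IsDirPath N.tail N.head (N.source i) N.sink p →
        ∃ e ∈ p, e ∈ C.toRight := by
      intro i hi p hp
      obtain ⟨j, hj⟩ := (Finset.mem_filter.mp hi).2
      exact N.exists_mem_of_isDirPath hS hSCr hp fun e he => by
        simpa using hSC _ hj _ (Feeds.source i j e he)
    have hk : 0 < k := by
      obtain ⟨j, -⟩ := (Finset.mem_filter.mp hi).2
      exact j.pos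
    have h3 := hcut hk C.toRight ⟨i, hJcut i hi⟩
    have h4 : J.card ≤ (N.cutSources C.toRight).ncard := by
      rw [← Set.ncard_coe_finset]
      refine Set.ncard_le_ncard (fun i hi => ?_) (Set.toFinite _)
      rintro ⟨p, hp, hpC⟩
      obtain ⟨e, he, heC⟩ := hJcut i hi p hp
      exact hpC e he heC
    have h5 : J.card * k ≤ k * (N.cutSources C.toRight).ncard := by
      rw [mul_comm]; exact Nat.mul_le_mul_left k h4
    omega

/-- A linking yields a code where `z ↦ zG` is injective on errors supported on `ρ`. Its `q ^ |ρ|`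
values lie in `Δ(ρ')`, which has at most `q ^ |ρ'|` elements. A single linking needs no assumption
on `q`. -/
theorem card_le_card_of_dominated [Fintype F] {ρ ρ' : Finset E}
    (hρ : ∃ f, IsLinking (N.Feeds 0) (N.endLinks 0) (startLinks 0 ρ) f)
    (h : N.Dominated F ρ ρ') : ρ.card ≤ ρ'.card := by
  classical
  obtain ⟨𝒞, h𝒞⟩ := N.exists_linearCode_of_linkings (F := F) (fun _ : Unit => ρ) (fun _ => hρ)
    (by rw [Fintype.card_unit]; exact Fintype.card_pos)
  let ext : (ρ → F) → E → F := fun z e => if h : e ∈ ρ then z ⟨e, h⟩ else 0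
  have hext : ∀ z, ∀ e ∉ ρ, ext z e = 0 := fun z e he => dif_neg he
  choose z' hz' hzz' using fun z => h 0 𝒞 ⟨ext z, hext z, rfl⟩
  have hinj : Function.Injective fun (z : ρ → F) (e : ρ') => z' z e := by
    intro z w hzw
    have hzw' : z' z = z' w := by
      funext e
      by_cases he : e ∈ ρ'
      · exact congrFun hzw ⟨e, he⟩
      · rw [hz' z e he, hz' w e he]
    have h1 := (h𝒞 () 0 (ext z - ext w) (fun e he => by simp [hext z e he, hext w e he]) (by
      rw [Matrix.zero_vecMul, Matrix.sub_vecMul, hzz', hzz', hzw', sub_self])).2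
    funext e
    simpa [ext, sub_eq_zero] using congrFun h1 e
  have h2 := Fintype.card_le_of_injective _ hinj
  rw [Fintype.card_fun, Fintype.card_fun, Fintype.card_coe, Fintype.card_coe] at h2
  exact (Nat.pow_le_pow_iff_right Fintype.one_lt_card).mp h2

/-- Converse to `exists_isLinking_startLinks` at `k = 0`. Full rank thus passes to any larger
pattern linked by the same `f`. -/
theorem patternRank_eq_card_of_isLinking [Fintype F] {ρ : Finset E}
    (hρ : ∃ f, IsLinking (N.Feeds 0) (N.endLinks 0) (startLinks 0 ρ) f) :
    N.patternRank F ρ = ρ.card := by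
  obtain ⟨ρ', h, h'⟩ := N.exists_dominated_card_eq_patternRank F ρ
  have h1 := N.card_le_card_of_dominated F hρ h
  have h2 := N.patternRank_le F (N.dominated_of_subset F (Finset.Subset.refl ρ))
  omega

/-- A pattern with at most `δ` links is dominated by one of size and rank `δ`. -/
theorem exists_mem_fullRankPatterns [Fintype F] {ρ : Finset E} {δ : ℕ} (hρ : ρ.card ≤ δ)
    (hδ : δ ≤ N.sinkLinks.card) : ∃ ρ' ∈ N.fullRankPatterns F δ, N.Dominated F ρ ρ' := by
  classical
  obtain ⟨ρ₁, hd, hc⟩ := N.exists_dominated_card_eq_patternRank F ρ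
  -- Domination is transitive, so a smallest pattern dominating `ρ` has full rank.
  have hρ₁ : N.patternRank F ρ₁ = ρ₁.card := by
    obtain ⟨ρ₂, hd', hc'⟩ := N.exists_dominated_card_eq_patternRank F ρ₁
    have h1 := N.patternRank_le F (ρ := ρ) (ρ' := ρ₂) fun k 𝒞 => (hd k 𝒞).trans (hd' k 𝒞)
    have h2 := N.patternRank_le F (N.dominated_of_subset F (Finset.Subset.refl ρ₁))
    omega
  have hle := N.patternRank_le F (N.dominated_of_subset F (Finset.Subset.refl ρ))
  obtain ⟨f, hf⟩ := N.exists_isLinking_startLinks F hρ₁ (k := 0) (by simp)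
  obtain ⟨A, hA, hAc, hfA⟩ := hf.exists_superset (n := δ)
    (by simp [startLinks]; omega)
    (by simpa [endLinks] using hδ)
  have hAr : startLinks 0 A.toRight = A := by
    ext (ij | e)
    · exact ij.2.elim0
    · simp [startLinks]
  have hcard : A.toRight.card = δ := by
    rw [← hAc]
    exact (by simp [startLinks] : _ = (startLinks 0 A.toRight).card).trans (congrArg _ hAr)
  refine ⟨A.toRight, ⟨hcard, ?_⟩, fun k 𝒞 => (hd k 𝒞).trans
    (N.dominated_of_subset F (fun e he => ?_) k 𝒞)⟩
  · rw [← hcard]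
    exact N.patternRank_eq_card_of_isLinking F ⟨f, by rwa [hAr]⟩
  · exact Finset.mem_toRight.mpr (hA (by simp [startLinks, he]))

theorem targetMatrix_one (k : ℕ) :
    targetMatrix (1 : Matrix (Fin s) (Fin s) F) k = 1 :=
  Matrix.one_kronecker_one

/-! ### The upper bound on the minimum distance -/

/-- The Singleton bound. -/
theorem LinearCode.exists_pattern_of_cut {N : AcyclicNetwork V E s} {F : Type*} [Field F]
    [Fintype F] {k : ℕ} (𝒞 : N.LinearCode F k) (hk : 0 < k) {C : Finset E} (hC : C ∈ N.cuts)
    {δ : ℕ} (hδ : C.card = δ + k * (N.cutSources C).ncard) :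
    ∃ (ρ : Finset E) (x : Fin s × Fin k → F), x ≠ 0 ∧
      Matrix.vecMul x 𝒞.globalMatrix ∈ 𝒞.Delta ρ ∧ ρ.card = δ + 1 := by
  classical
  have hpos : 0 < (N.cutSources C).ncard := by
    obtain ⟨i, hi⟩ := hC
    refine (Set.ncard_pos (Set.toFinite _)).mpr ⟨i, ?_⟩
    rintro ⟨p, hp, hpC⟩
    obtain ⟨e, he, heC⟩ := hi p hp
    exact hpC e he heC
  have hmul : 0 < k * (N.cutSources C).ncard := Nat.mul_pos hk hpos
  obtain ⟨ρ, hρC, hρ⟩ := Finset.exists_subset_card_eq (s := C) (n := δ + 1) (by omega)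
  let ext : (N.cutSources C × Fin k → F) → Fin s × Fin k → F := fun x ij =>
    if h : ij.1 ∈ N.cutSources C then x (⟨ij.1, h⟩, ij.2) else 0
  have hsim : ∀ x, Matrix.vecMul (ext x) 𝒞.globalMatrix ∈ 𝒞.Delta C := fun x =>
    𝒞.exists_simulation_of_mem_cutSources fun i j hi => dif_neg hi
  choose z hz hxz using hsim
  -- `C \ ρ` has `k|I_C| - 1` links, one fewer than the free message symbols. Two messages therefore
  -- have simulating errors that agree on `C \ ρ`, and their difference is simulated on `ρ`.
  obtain ⟨x, y, hxy, heq⟩ := Fintype.exists_ne_map_eq_of_card_lt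
    (fun (x : N.cutSources C × Fin k → F) (e : ↥(C \ ρ)) => z x e) (by
      rw [Fintype.card_fun, Fintype.card_fun]
      refine Nat.pow_lt_pow_right Fintype.one_lt_card ?_
      rw [Fintype.card_coe, Finset.card_sdiff_of_subset hρC, Fintype.card_prod, Fintype.card_fin,
        ← Nat.card_eq_fintype_card, Nat.card_coe_set_eq, mul_comm _ k]
      omega)
  refine ⟨ρ, ext x - ext y, ?_, ⟨z x - z y, fun e he => ?_, ?_⟩, hρ⟩
  · intro h
    apply hxy
    funext ⟨i, j⟩
    have := congrFun h (i.1, j)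
    simpa [ext, sub_eq_zero] using this
  · by_cases heC : e ∈ C
    · have := congrFun heq ⟨e, Finset.mem_sdiff.mpr ⟨heC, he⟩⟩
      simpa [sub_eq_zero] using this
    · simp [hz x e heC, hz y e heC]
  · rw [Matrix.sub_vecMul, Matrix.sub_vecMul, hxz, hxz]

end Fintype

theorem sinkLinks_mem_cuts [Fintype E] (hs : 0 < s) : N.sinkLinks ∈ N.cuts :=
  ⟨⟨0, hs⟩, fun p ⟨hne, _, h, _⟩ => ⟨_, List.getLast_mem hne, by simpa using h⟩⟩

end AcyclicNetwork

/-! ### The main theorem -/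

theorem mainTheorem2 {V E F : Type*} [Finite V] [Fintype E] [DecidableEq E]
    [Field F] [Fintype F] {s : ℕ} (N : AcyclicNetwork V E s) (k : ℕ) (hk : 0 < k)
    (δ : ℕ)
    (hδ : IsLeast ((fun C : Finset E => (C.card : ℤ) - (k : ℤ) * ((N.cutSources C).ncard : ℤ)) ''
      N.cuts) (δ : ℤ))
    (hq : (N.fullRankPatterns F δ).ncard ≤ Fintype.card F) :
    ∃ 𝒞 : N.LinearCode F k,
      𝒞.Computes (1 : Matrix (Fin s) (Fin s) F) ∧
      𝒞.minDist (1 : Matrix (Fin s) (Fin s) F) = δ + 1 := by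
  classical
  obtain ⟨⟨C, hC, hCδ⟩, hmin⟩ := hδ
  have hcut : ∀ C ∈ N.cuts, δ + k * (N.cutSources C).ncard ≤ C.card := by
    intro C hC
    have := hmin ⟨C, hC, rfl⟩
    dsimp only at this
    zify
    linarith
  have hCδ' : C.card = δ + k * (N.cutSources C).ncard := by
    zify
    dsimp only at hCδ
    linarith
  have hs : 0 < s := by
    obtain ⟨i, -⟩ := hC
    exact i.pos
  -- The links into the sink form a cut, which leaves room to extend patterns to `δ` linked links.
  have hδT : δ ≤ N.sinkLinks.card :=
    (Nat.le_add_right _ _).trans (hcut _ (N.sinkLinks_mem_cuts hs))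
  obtain ⟨𝒞, h𝒞⟩ := N.exists_linearCode_of_linkings (F := F) (k := k)
    (fun ρ : N.fullRankPatterns F δ => (ρ : Finset E))
    (fun ρ => N.exists_isLinking_startLinks F (ρ.2.2.trans ρ.2.1.symm)
      fun _ C hC => by rw [ρ.2.1]; exact hcut C hC)
    (by rwa [← Nat.card_eq_fintype_card, Nat.card_coe_set_eq])
  have hdist : ∀ (ρ : Finset E) (x : Fin s × Fin k → F), ρ.card ≤ δ →
      Matrix.vecMul x 𝒞.globalMatrix ∈ 𝒞.Delta ρ → x = 0 := by
    intro ρ x hρ hx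
    obtain ⟨ρ', hρ', hd⟩ := N.exists_mem_fullRankPatterns F hρ hδT
    obtain ⟨z, hz, hxz⟩ := hd k 𝒞 hx
    exact (h𝒞 ⟨ρ', hρ'⟩ x z hz hxz).1
  have hinj : Function.Injective fun x => Matrix.vecMul x 𝒞.globalMatrix := by
    intro x y hxy
    rw [← sub_eq_zero]
    -- The empty pattern turns the distance bound into injectivity, hence decodability.
    refine hdist ∅ _ (Nat.zero_le _) ⟨0, fun _ _ => rfl, ?_⟩
    rw [Matrix.sub_vecMul, Matrix.zero_vecMul]
    exact sub_eq_zero.mpr hxy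
  refine ⟨𝒞, ⟨Function.invFun fun x => Matrix.vecMul x 𝒞.globalMatrix, fun x => ?_⟩, ?_⟩
  · rw [AcyclicNetwork.targetMatrix_one, Matrix.vecMul_one]
    exact Function.leftInverse_invFun hinj x
  · apply IsLeast.csInf_eq
    constructor
    · obtain ⟨ρ, x, hx, hxρ, hρ⟩ := 𝒞.exists_pattern_of_cut hk hC hCδ'
      refine ⟨ρ, ⟨_, ⟨x, ?_, rfl⟩, hxρ⟩, hρ⟩
      rwa [AcyclicNetwork.targetMatrix_one, Matrix.vecMul_one]
    · rintro m ⟨ρ, ⟨y, ⟨x, hx, rfl⟩, hxρ⟩, rfl⟩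
      rw [AcyclicNetwork.targetMatrix_one, Matrix.vecMul_one] at hx
      by_contra h
      exact hx (hdist ρ x (by omega) hxρ)
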